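/- Let $n,m\ge 0$ be integers, let $\Lambda:\mathbb{R}^n\to GL(n,\mathbb{R})$ be an arbitrary map and let $\mu$ be a Radon measure on $\mathbb{R}^n$. Write $B(x,r)$ for the closed Euclidean ball and $B_\Lambda(a,r)=a+\Lambda(a)B(0,r)$. Suppose that for $\mu$-almost every $a\in\mathbb{R}^n$ the $m$-dimensional $\Lambda$-density $$\theta^m_\Lambda(\mu,a)=\lim_{r\downarrow 0}\frac{\mu(B_\Lambda(a,r))}{r^m}$$ exists and satisfies $0<\theta^m_\Lambda(\mu,a)<\infty$. For $a\in\mathbb{R}^n$ let $\mathrm{Tan}_\Lambda(\mu,a)$ be the set of all non-zero Radon measures $\nu$ on $\mathbb{R}^n$ for which there are $c_i>0$ and $r_i\downarrow 0$ such that the measures $c_i\,T^\Lambda_{a,r_i}[\mu]$ converge to $\nu$ in the weak-$*$ sense (tested against continuous functions of compact support), where $T^\Lambda_{a,r}[\mu]$ is the image of $\mu$ under $y\mapsto \Lambda(a)^{-1}\big(\tfrac{y-a}{r}\big)$. Then for $\mu$-almost every $a$, every $\nu\in\mathrm{Tan}_\Lambda(\mu,a)$ is $m$-uniform (that is, $0\in\operatorname{spt}\nu$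 and there is $c>0$ with $\nu(B(x,r))=c\,r^m$ for all $x\in\operatorname{spt}\nu$ and all $r>0$), and more precisely $$\nu(B(x,r))=\nu(B(0,1))\,r^m\qquad\text{for all }x\in\operatorname{spt}\nu\text{ and all }r>0.$$ -/

import Mathlib

open MeasureTheory Filter Topology Set
open scoped ENNReal NNReal MatrixGroups

namespace LambdaTangent

/-- The linear map `y ↦ M y` of `ℝⁿ` given by an invertible matrix `M`. -/
noncomputable def act {n : ℕ} (M : GL (Fin n) ℝ) :
    EuclideanSpace ℝ (Fin n) →L[ℝ] EuclideanSpace ℝ (Fin n) :=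
  Matrix.toEuclideanCLM (n := Fin n) (𝕜 := ℝ) (M : Matrix (Fin n) (Fin n) ℝ)

/-- The ellipse `B_Λ(a, r) = a + Λ(a) B(0, r)`, with `B(0, r)` the closed Euclidean ball. -/
def ellipse {n : ℕ} (Λ : EuclideanSpace ℝ (Fin n) → GL (Fin n) ℝ)
    (a : EuclideanSpace ℝ (Fin n)) (r : ℝ) : Set (EuclideanSpace ℝ (Fin n)) :=
  (fun y => a + act (Λ a) y) '' Metric.closedBall 0 r

/-- The upper `Λ`-density `limsup_{r ↓ 0} μ(B_Λ(a, r)) / r ^ m`. -/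
noncomputable def upperDensity {n : ℕ} (m : ℕ) (Λ : EuclideanSpace ℝ (Fin n) → GL (Fin n) ℝ)
    (μ : Measure (EuclideanSpace ℝ (Fin n))) (a : EuclideanSpace ℝ (Fin n)) : ℝ≥0∞ :=
  limsup (fun r : ℝ => μ (ellipse Λ a r) / ENNReal.ofReal (r ^ m)) (𝓝[>] 0)

/-- The lower `Λ`-density `liminf_{r ↓ 0} μ(B_Λ(a, r)) / r ^ m`. -/
noncomputable def lowerDensity {n : ℕ} (m : ℕ) (Λ : EuclideanSpace ℝ (Fin n) → GL (Fin n) ℝ)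
    (μ : Measure (EuclideanSpace ℝ (Fin n))) (a : EuclideanSpace ℝ (Fin n)) : ℝ≥0∞ :=
  liminf (fun r : ℝ => μ (ellipse Λ a r) / ENNReal.ofReal (r ^ m)) (𝓝[>] 0)

/-- The `m`-dimensional `Λ`-density of `μ` at `a` exists, as a positive and finite number:
the lower and upper densities agree, and their common value lies in `(0, ∞)`. -/
def HasDensity {n : ℕ} (m : ℕ) (Λ : EuclideanSpace ℝ (Fin n) → GL (Fin n) ℝ)
    (μ : Measure (EuclideanSpace ℝ (Fin n))) (a : EuclideanSpace ℝ (Fin n)) : Prop :=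
  lowerDensity m Λ μ a = upperDensity m Λ μ a ∧
    0 < lowerDensity m Λ μ a ∧ upperDensity m Λ μ a < ∞

/-- The rescaling `T^Λ_{a, r}(y) = Λ(a)⁻¹ ((y - a) / r)`. -/
noncomputable def rescale {n : ℕ} (Λ : EuclideanSpace ℝ (Fin n) → GL (Fin n) ℝ)
    (a : EuclideanSpace ℝ (Fin n)) (r : ℝ) (y : EuclideanSpace ℝ (Fin n)) :
    EuclideanSpace ℝ (Fin n) :=
  act (Λ a)⁻¹ (r⁻¹ • (y - a))

/-- Weak-* convergence of (Radon) measures on `ℝⁿ`: convergence of the integrals of all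
continuous compactly supported functions. -/
def WeakStarTendsto {n : ℕ} (μs : ℕ → Measure (EuclideanSpace ℝ (Fin n)))
    (ν : Measure (EuclideanSpace ℝ (Fin n))) : Prop :=
  ∀ f : EuclideanSpace ℝ (Fin n) → ℝ, Continuous f → HasCompactSupport f →
    Tendsto (fun i => ∫ y, f y ∂(μs i)) atTop (𝓝 (∫ y, f y ∂ν))

/-- The set `Tan_Λ(μ, a)` of `Λ`-tangents of `μ` at `a`: the non-zero Radon (that is, locally
finite Borel) measures on `ℝⁿ` of the form `lim c_i T^Λ_{a, r_i}[μ]` with `c_i > 0`, `r_i ↓ 0`. -/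
def Tan {n : ℕ} (Λ : EuclideanSpace ℝ (Fin n) → GL (Fin n) ℝ)
    (μ : Measure (EuclideanSpace ℝ (Fin n))) (a : EuclideanSpace ℝ (Fin n)) :
    Set (Measure (EuclideanSpace ℝ (Fin n))) :=
  {ν | IsLocallyFiniteMeasure ν ∧ ν ≠ 0 ∧
    ∃ (c : ℕ → ℝ≥0) (r : ℕ → ℝ), (∀ i, 0 < c i) ∧ (∀ i, 0 < r i) ∧ Tendsto r atTop (𝓝 0) ∧
      WeakStarTendsto (fun i => c i • μ.map (rescale Λ a (r i))) ν}

/-- `ν` is an `m`-uniform measure on `ℝⁿ`. -/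
def IsUniform {n : ℕ} (m : ℕ) (ν : Measure (EuclideanSpace ℝ (Fin n))) : Prop :=
  IsLocallyFiniteMeasure ν ∧ 0 ∈ ν.support ∧
    ∃ c : ℝ, 0 < c ∧ ∀ x ∈ ν.support, ∀ r : ℝ, 0 < r →
      ν (Metric.closedBall x r) = ENNReal.ofReal (c * r ^ m)

end LambdaTangent

/-!
Split the points with positive finite density into countably many sets on each of which the
matrices `Λ` differ by factors close to `1`, the densities differ by factors close to `1`, and the
density is nearly attained at all scales below a fixed radius. Almost every `a` is a density point
of the piece `S` containing it. If `ν` is a limit of blow-ups of `μ` at `a`, then each point of its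
support is a limit of rescaled points `z` of `S`, so the mass of `B(x, s)` can be read off the
ellipses centred at such `z`: up to factors close to `1` they are the ellipses of `a`, translated,
and they have the mass prescribed by the density at `a`.
-/

namespace LambdaTangent

section CountableCover

theorem exists_countable_cover_of_eventually_nhds_diag {α X : Type*} [TopologicalSpace X]
    [SecondCountableTopology X] {A : Set α} {F : α → X} {R : X → X → Prop}
    (h : ∀ a ∈ A, ∀ᶠ z in 𝓝 (F a, F a), R z.1 z.2) :
    ∃ 𝒱 : Set (Set α), 𝒱.Countable ∧ A ⊆ ⋃₀ 𝒱 ∧ ∀ V ∈ 𝒱, ∀ a ∈ V, ∀ b ∈ V, R (F a) (F b) := by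
  have hU : ∀ p ∈ F '' A, ∃ U ∈ 𝓝 p, ∀ q ∈ U, ∀ q' ∈ U, R q q' := by
    rintro _ ⟨a, ha, rfl⟩
    obtain ⟨U, hU, hsub⟩ := mem_prod_same_iff.1 (nhds_prod_eq (x := F a) (y := F a) ▸ h a ha)
    exact ⟨U, hU, fun q hq q' hq' => hsub (mk_mem_prod hq hq')⟩
  choose! U hUnhds hUrel using hU
  obtain ⟨t, htA, htc, hcov⟩ := TopologicalSpace.countable_cover_nhdsWithin
    fun p hp => mem_nhdsWithin_of_mem_nhds (hUnhds p hp)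
  refine ⟨(fun p => F ⁻¹' U p) '' t, htc.image _, fun a ha => ?_, ?_⟩
  · obtain ⟨p, hp, hap⟩ := mem_iUnion₂.1 (hcov ⟨a, ha, rfl⟩)
    exact ⟨_, ⟨p, hp, rfl⟩, hap⟩
  · rintro _ ⟨p, hp, rfl⟩ a ha b hb
    exact hUrel p (htA hp) _ ha _ hb

end CountableCover

section DensityPoint

variable {X : Type*} [MeasurableSpace X] {μ : Measure X}

theorem measure_le_mul_one_sub_of_disjoint {S Q V : Set X} (hQ : MeasurableSet Q) (hQV : Q ⊆ V)
    (hd : Disjoint S Q) (hV : μ V ≠ ∞) : μ Q ≤ μ V * (1 - μ (S ∩ V) / μ V) := by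
  rcases eq_or_ne (μ V) 0 with h0 | h0
  · simpa [h0] using (measure_mono hQV).trans_eq h0
  · have hsum : μ (S ∩ V) + μ Q ≤ μ V := by
      rw [← measure_union (hd.mono_left inter_subset_left) hQ]
      exact measure_mono (union_subset inter_subset_right hQV)
    rw [ENNReal.mul_sub fun _ _ => hV, mul_one, ENNReal.mul_div_cancel h0 hV]
    exact ENNReal.le_sub_of_add_le_left (ne_top_of_le_ne_top hV (measure_mono inter_subset_right))
      hsum

variable [MetricSpace X]

/-- `a` is a Lebesgue density point of `S`, in terms of closed balls. The set `S` need not be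
measurable. -/
def IsDensityPoint (μ : Measure X) (S : Set X) (a : X) : Prop :=
  Tendsto (fun r => μ (S ∩ Metric.closedBall a r) / μ (Metric.closedBall a r)) (𝓝[>] 0) (𝓝 1)

theorem ae_forall_mem_isDensityPoint [SecondCountableTopology X] [HasBesicovitchCovering X]
    [BorelSpace X] [IsLocallyFiniteMeasure μ] {𝒮 : Set (Set X)} (h𝒮 : 𝒮.Countable) :
    ∀ᵐ a ∂μ, ∀ S ∈ 𝒮, a ∈ S → IsDensityPoint μ S a :=
  (ae_ball_iff h𝒮).2 fun S _ => ae_imp_of_ae_restrict (Besicovitch.ae_tendsto_measure_inter_div μ S)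

end DensityPoint

section WeakStar

variable {n : ℕ} {μs : ℕ → Measure (EuclideanSpace ℝ (Fin n))}
  {ν : Measure (EuclideanSpace ℝ (Fin n))}

theorem WeakStarTendsto.comp (h : WeakStarTendsto μs ν) {φ : ℕ → ℕ}
    (hφ : Tendsto φ atTop atTop) : WeakStarTendsto (μs ∘ φ) ν :=
  fun f hf hfc => (h f hf hfc).comp hφ

variable [IsLocallyFiniteMeasure ν]

theorem WeakStarTendsto.measure_le_liminf_of_isOpen (h : WeakStarTendsto μs ν)
    {U : Set (EuclideanSpace ℝ (Fin n))} (hU : IsOpen U) :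
    ν U ≤ liminf (fun i => μs i U) atTop := by
  rw [hU.measure_eq_iSup_isCompact]
  refine iSup₂_le fun K hKU => iSup_le fun hK => ?_
  obtain ⟨f, hf1, hf0, hfc, hf⟩ := exists_continuous_one_zero_of_isCompact hK hU.isClosed_compl
    (disjoint_compl_right_iff_subset.2 hKU)
  calc ν K ≤ ENNReal.ofReal (∫ y, f y ∂ν) :=
        (f.continuous.integrable_of_hasCompactSupport hfc).measure_le_integral
          (Eventually.of_forall fun y => (hf y).1) fun y hy => (hf1 hy).ge
    _ = liminf (fun i => ENNReal.ofReal (∫ y, f y ∂μs i)) atTop :=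
        (ENNReal.tendsto_ofReal (h f f.continuous hfc)).liminf_eq.symm
    _ ≤ liminf (fun i => μs i U) atTop := liminf_le_liminf <| Eventually.of_forall fun i =>
        integral_le_measure (fun y _ => (hf y).2) fun y hy => (hf0 hy).le

theorem WeakStarTendsto.limsup_measure_le_of_isCompact [∀ i, IsLocallyFiniteMeasure (μs i)]
    (h : WeakStarTendsto μs ν) {K : Set (EuclideanSpace ℝ (Fin n))} (hK : IsCompact K) :
    limsup (fun i => μs i K) atTop ≤ ν K := by
  rw [K.measure_eq_iInf_isOpen ν]
  refine le_iInf₂ fun U hKU => le_iInf fun hU => ?_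
  obtain ⟨f, hf1, hf0, hfc, hf⟩ := exists_continuous_one_zero_of_isCompact hK hU.isClosed_compl
    (disjoint_compl_right_iff_subset.2 hKU)
  calc limsup (fun i => μs i K) atTop
      ≤ limsup (fun i => ENNReal.ofReal (∫ y, f y ∂μs i)) atTop :=
        limsup_le_limsup <| Eventually.of_forall fun i =>
          (f.continuous.integrable_of_hasCompactSupport hfc).measure_le_integral
            (Eventually.of_forall fun y => (hf y).1) fun y hy => (hf1 hy).ge
    _ = ENNReal.ofReal (∫ y, f y ∂ν) :=
        (ENNReal.tendsto_ofReal (h f f.continuous hfc)).limsup_eq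
    _ ≤ ν U := integral_le_measure (fun y _ => (hf y).2) fun y hy => (hf0 hy).le

end WeakStar

variable {n m : ℕ} {Λ : EuclideanSpace ℝ (Fin n) → GL (Fin n) ℝ}
  {μ ν : Measure (EuclideanSpace ℝ (Fin n))} {a x y z : EuclideanSpace ℝ (Fin n)}

section Ellipse

theorem act_mul (M N : GL (Fin n) ℝ) : act (M * N) = act M * act N := by
  simp only [act, Units.val_mul, map_mul]

theorem act_one : act (1 : GL (Fin n) ℝ) = 1 := by
  simp only [act, Units.val_one, map_one]

theorem act_inv_mul_act (M : GL (Fin n) ℝ) : act M⁻¹ * act M = 1 := by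
  rw [← act_mul, inv_mul_cancel, act_one]

theorem act_inv_act_apply (M : GL (Fin n) ℝ) (y : EuclideanSpace ℝ (Fin n)) :
    act M⁻¹ (act M y) = y :=
  DFunLike.congr_fun (act_inv_mul_act M) y

theorem act_act_inv_apply (M : GL (Fin n) ℝ) (y : EuclideanSpace ℝ (Fin n)) :
    act M (act M⁻¹ y) = y := by
  simpa only [inv_inv] using act_inv_act_apply M⁻¹ y

theorem act_inv_apply_eq_mul_apply (M N : GL (Fin n) ℝ) (y : EuclideanSpace ℝ (Fin n)) :
    act M⁻¹ y = (act M⁻¹ * act N) (act N⁻¹ y) := by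
  rw [mul_apply_eq_comp, act_act_inv_apply]

theorem mem_ellipse {t : ℝ} : y ∈ ellipse Λ a t ↔ ‖act (Λ a)⁻¹ (y - a)‖ ≤ t := by
  constructor
  · rintro ⟨z, hz, rfl⟩
    simpa [act_inv_act_apply] using hz
  · intro h
    exact ⟨act (Λ a)⁻¹ (y - a), by simpa using h, by simp [act_act_inv_apply]⟩

theorem ellipse_subset_closedBall {T : ℝ} (hT : ‖act (Λ a)‖ ≤ T) (t : ℝ) :
    ellipse Λ a t ⊆ Metric.closedBall a (T * t) := by
  intro y hy
  rw [mem_closedBall_iff_norm, ← act_act_inv_apply (Λ a) (y - a)]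
  exact ContinuousLinearMap.le_of_opNorm_le_of_le _ hT (mem_ellipse.1 hy)

theorem closedBall_subset_ellipse {T : ℝ} (hT : ‖act (Λ a)⁻¹‖ ≤ T) (t : ℝ) :
    Metric.closedBall a t ⊆ ellipse Λ a (T * t) := fun _ hy =>
  mem_ellipse.2 <| ContinuousLinearMap.le_of_opNorm_le_of_le _ hT (mem_closedBall_iff_norm.1 hy)

end Ellipse

section Rescale

theorem continuous_rescale (Λ : EuclideanSpace ℝ (Fin n) → GL (Fin n) ℝ)
    (a : EuclideanSpace ℝ (Fin n)) (r : ℝ) : Continuous (rescale Λ a r) := by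
  unfold rescale
  fun_prop

theorem rescale_self (a : EuclideanSpace ℝ (Fin n)) (r : ℝ) : rescale Λ a r a = 0 := by
  simp only [rescale, sub_self, smul_zero, map_zero]

theorem rescale_sub_rescale (a y z : EuclideanSpace ℝ (Fin n)) (r : ℝ) :
    rescale Λ a r y - rescale Λ a r z = r⁻¹ • act (Λ a)⁻¹ (y - z) := by
  rw [rescale, rescale, ← map_sub, ← smul_sub, map_smul, sub_sub_sub_cancel_right]

variable {r : ℝ} (hr : 0 < r)
include hr

theorem rescale_mem_closedBall_rescale_iff {t : ℝ} :
    rescale Λ a r y ∈ Metric.closedBall (rescale Λ a r z) t ↔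
      ‖act (Λ a)⁻¹ (y - z)‖ ≤ t * r := by
  rw [mem_closedBall_iff_norm, rescale_sub_rescale, norm_smul, norm_inv, Real.norm_of_nonneg hr.le,
    inv_mul_le_iff₀ hr, mul_comm]

theorem rescale_preimage_closedBall_zero (t : ℝ) :
    rescale Λ a r ⁻¹' Metric.closedBall 0 t = ellipse Λ a (t * r) := by
  ext y
  rw [mem_preimage, ← rescale_self (Λ := Λ) a r, rescale_mem_closedBall_rescale_iff hr, mem_ellipse]

theorem ellipse_subset_rescale_preimage {K : ℝ} (hK : ‖act (Λ a)⁻¹ * act (Λ z)‖ ≤ K) (t : ℝ) :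
    ellipse Λ z (t * r) ⊆ rescale Λ a r ⁻¹' Metric.closedBall (rescale Λ a r z) (K * t) := by
  intro y hy
  rw [mem_preimage, rescale_mem_closedBall_rescale_iff hr, act_inv_apply_eq_mul_apply _ (Λ z),
    mul_assoc]
  exact ContinuousLinearMap.le_of_opNorm_le_of_le _ hK (mem_ellipse.1 hy)

theorem rescale_preimage_subset_ellipse {K : ℝ} (hK : ‖act (Λ z)⁻¹ * act (Λ a)‖ ≤ K) (t : ℝ) :
    rescale Λ a r ⁻¹' Metric.closedBall (rescale Λ a r z) t ⊆ ellipse Λ z (K * t * r) := by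
  intro y hy
  rw [mem_ellipse, act_inv_apply_eq_mul_apply _ (Λ a), mul_assoc]
  exact ContinuousLinearMap.le_of_opNorm_le_of_le _ hK
    ((rescale_mem_closedBall_rescale_iff hr).1 hy)

theorem rescale_preimage_subset_closedBall {T : ℝ} (hT : ‖act (Λ a)‖ ≤ T)
    (x : EuclideanSpace ℝ (Fin n)) (t : ℝ) :
    rescale Λ a r ⁻¹' Metric.closedBall x t ⊆
      Metric.closedBall a (T * (t + dist x 0) * r) := by
  have hsub : Metric.closedBall x t ⊆ Metric.closedBall 0 (t + dist x 0) :=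
    Metric.closedBall_subset_closedBall' le_rfl
  refine (preimage_mono hsub).trans ?_
  rw [rescale_preimage_closedBall_zero hr, mul_assoc]
  exact ellipse_subset_closedBall hT _

end Rescale

section Blowup

/-- The blow-up `c T^Λ_{a, r}[μ]` of `μ` at `a`. -/
noncomputable def blowup (Λ : EuclideanSpace ℝ (Fin n) → GL (Fin n) ℝ)
    (μ : Measure (EuclideanSpace ℝ (Fin n))) (a : EuclideanSpace ℝ (Fin n)) (c : ℝ≥0) (r : ℝ) :
    Measure (EuclideanSpace ℝ (Fin n)) :=
  c • μ.map (rescale Λ a r)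

theorem blowup_apply {E : Set (EuclideanSpace ℝ (Fin n))} (hE : MeasurableSet E) (c : ℝ≥0)
    (r : ℝ) : blowup Λ μ a c r E = c * μ (rescale Λ a r ⁻¹' E) := by
  rw [blowup, Measure.smul_apply, Measure.map_apply (continuous_rescale Λ a r).measurable hE,
    ENNReal.smul_def, smul_eq_mul]

theorem isLocallyFiniteMeasure_blowup [IsLocallyFiniteMeasure μ] (c : ℝ≥0) {r : ℝ} (hr : 0 < r) :
    IsLocallyFiniteMeasure (blowup Λ μ a c r) := by
  refine ⟨fun x => ⟨Metric.closedBall x 1, Metric.closedBall_mem_nhds x one_pos, ?_⟩⟩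
  rw [blowup_apply measurableSet_closedBall]
  exact ENNReal.mul_lt_top ENNReal.coe_lt_top <|
    (measure_mono (rescale_preimage_subset_closedBall hr le_rfl x 1)).trans_lt
      measure_closedBall_lt_top

end Blowup

section Density

/-- The `Λ`-density of `μ` at `a` as a real number, which is meaningful when `HasDensity` holds. -/
noncomputable def density (m : ℕ) (Λ : EuclideanSpace ℝ (Fin n) → GL (Fin n) ℝ)
    (μ : Measure (EuclideanSpace ℝ (Fin n))) (a : EuclideanSpace ℝ (Fin n)) : ℝ :=
  (lowerDensity m Λ μ a).toReal

theorem density_nonneg (a : EuclideanSpace ℝ (Fin n)) : 0 ≤ density m Λ μ a :=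
  ENNReal.toReal_nonneg

theorem HasDensity.lowerDensity_ne_top (ha : HasDensity m Λ μ a) : lowerDensity m Λ μ a ≠ ∞ :=
  (ha.1.trans_lt ha.2.2).ne

theorem HasDensity.density_pos (ha : HasDensity m Λ μ a) : 0 < density m Λ μ a :=
  ENNReal.toReal_pos ha.2.1.ne' ha.lowerDensity_ne_top

theorem HasDensity.tendsto (ha : HasDensity m Λ μ a) :
    Tendsto (fun r : ℝ => μ (ellipse Λ a r) / ENNReal.ofReal (r ^ m)) (𝓝[>] 0)
      (𝓝 (ENNReal.ofReal (density m Λ μ a))) := by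
  rw [density, ENNReal.ofReal_toReal ha.lowerDensity_ne_top]
  exact tendsto_of_liminf_eq_limsup rfl ha.1.symm

/-- The points `b` whose density is attained up to the factor `K` by all ellipses `B_Λ(b, r)` of
radius `r < ρ`. -/
def uniformDensitySet (m : ℕ) (Λ : EuclideanSpace ℝ (Fin n) → GL (Fin n) ℝ)
    (μ : Measure (EuclideanSpace ℝ (Fin n))) (K ρ : ℝ) : Set (EuclideanSpace ℝ (Fin n)) :=
  {b | ∀ r ∈ Ioo 0 ρ, μ (ellipse Λ b r) ∈
    Icc (ENNReal.ofReal (density m Λ μ b / K * r ^ m))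
      (ENNReal.ofReal (K * density m Λ μ b * r ^ m))}

theorem HasDensity.exists_mem_uniformDensitySet (ha : HasDensity m Λ μ a) {K : ℝ} (hK : 1 < K) :
    ∃ j : ℕ, a ∈ uniformDensitySet m Λ μ K (1 / ((j : ℝ) + 1)) := by
  have hpos := ha.density_pos
  have hlt : ENNReal.ofReal (density m Λ μ a) < ENNReal.ofReal (K * density m Λ μ a) :=
    (ENNReal.ofReal_lt_ofReal_iff (by positivity)).2 (lt_mul_of_one_lt_left hpos hK)
  have hgt : ENNReal.ofReal (density m Λ μ a / K) < ENNReal.ofReal (density m Λ μ a) :=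
    (ENNReal.ofReal_lt_ofReal_iff hpos).2 (div_lt_self hpos hK)
  obtain ⟨δ, hδ, hsub⟩ := mem_nhdsGT_iff_exists_Ioo_subset.1
    ((ha.tendsto.eventually_const_le hgt).and (ha.tendsto.eventually_le_const hlt))
  obtain ⟨j, hj⟩ := exists_nat_one_div_lt (mem_Ioi.1 hδ)
  refine ⟨j, fun r hr => ?_⟩
  obtain ⟨hle, hge⟩ := hsub ⟨hr.1, hr.2.trans hj⟩
  have hr0 : ENNReal.ofReal (r ^ m) ≠ 0 := (ENNReal.ofReal_pos.2 (pow_pos hr.1 m)).ne'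
  rw [ENNReal.ofReal_mul (by positivity), ENNReal.ofReal_mul (by positivity)]
  exact ⟨(ENNReal.le_div_iff_mul_le (Or.inl hr0) (Or.inl ENNReal.ofReal_ne_top)).1 hle,
    (ENNReal.div_le_iff hr0 ENNReal.ofReal_ne_top).1 hge⟩

end Density

section Comparable

/-- The data attached to a point: its matrix, the inverse of its matrix, and its density. -/
abbrev Shape (n : ℕ) : Type :=
  (EuclideanSpace ℝ (Fin n) →L[ℝ] EuclideanSpace ℝ (Fin n)) ×
    (EuclideanSpace ℝ (Fin n) →L[ℝ] EuclideanSpace ℝ (Fin n)) × ℝ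

/-- The shape of the ellipses at `a`, together with the density of `μ` at `a`. -/
noncomputable def shape (m : ℕ) (Λ : EuclideanSpace ℝ (Fin n) → GL (Fin n) ℝ)
    (μ : Measure (EuclideanSpace ℝ (Fin n))) (a : EuclideanSpace ℝ (Fin n)) : Shape n :=
  (act (Λ a), act (Λ a)⁻¹, density m Λ μ a)

/-- One-sided closeness of two shapes up to the factor `K`; only the conjunction of
`IsClose K p q` and `IsClose K q p` controls both matrices and both densities. -/
def IsClose (K : ℝ) (p q : Shape n) : Prop :=
  ‖p.2.1 * q.1‖ < K ∧ p.2.2 < K * q.2.2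

theorem HasDensity.eventually_isClose (ha : HasDensity m Λ μ a) {K : ℝ} (hK : 1 < K) :
    ∀ᶠ z in 𝓝 (shape m Λ μ a, shape m Λ μ a), IsClose K z.1 z.2 := by
  have hnorm : Continuous fun z : Shape n × Shape n => ‖z.1.2.1 * z.2.1‖ := by fun_prop
  have hfst : Continuous fun z : Shape n × Shape n => z.1.2.2 := by fun_prop
  have hsnd : Continuous fun z : Shape n × Shape n => K * z.2.2.2 := by fun_prop
  refine (hnorm.continuousAt.eventually_lt continuousAt_const ?_).and
    (hfst.continuousAt.eventually_lt hsnd.continuousAt (lt_mul_of_one_lt_left ha.density_pos hK))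
  rw [shape, act_inv_mul_act]
  exact ContinuousLinearMap.norm_id_le.trans_lt hK

/-- The points `b` of `S` have, up to the factor `K`, the same matrix as `a`, and their small
ellipses have, up to the factor `K`, the mass given by the density of `μ` at `a`. -/
def IsComparable (m : ℕ) (Λ : EuclideanSpace ℝ (Fin n) → GL (Fin n) ℝ)
    (μ : Measure (EuclideanSpace ℝ (Fin n))) (K ρ : ℝ) (a : EuclideanSpace ℝ (Fin n))
    (S : Set (EuclideanSpace ℝ (Fin n))) : Prop :=
  ∀ b ∈ S, ‖act (Λ a)⁻¹ * act (Λ b)‖ ≤ K ∧ ‖act (Λ b)⁻¹ * act (Λ a)‖ ≤ K ∧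
    ∀ r ∈ Ioo 0 ρ, μ (ellipse Λ b r) ∈
      Icc (ENNReal.ofReal (density m Λ μ a / K * r ^ m))
        (ENNReal.ofReal (K * density m Λ μ a * r ^ m))

theorem IsComparable.mono {K K' ρ : ℝ} {S : Set (EuclideanSpace ℝ (Fin n))}
    (h : IsComparable m Λ μ K ρ a S) (hK : 0 < K) (hKK' : K ≤ K') :
    IsComparable m Λ μ K' ρ a S := by
  intro b hb
  obtain ⟨hab, hba, hball⟩ := h b hb
  refine ⟨hab.trans hKK', hba.trans hKK', fun r hr => Icc_subset_Icc ?_ ?_ (hball r hr)⟩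
  all_goals
    have := density_nonneg (m := m) (Λ := Λ) (μ := μ) a
    have := hr.1.le
    gcongr

theorem isComparable_uniformDensitySet_inter {K ρ : ℝ} (hK : 1 < K)
    {V : Set (EuclideanSpace ℝ (Fin n))}
    (hV : ∀ b ∈ V, ∀ b' ∈ V, IsClose K (shape m Λ μ b) (shape m Λ μ b')) (ha : a ∈ V) :
    IsComparable m Λ μ (K * K) ρ a (uniformDensitySet m Λ μ K ρ ∩ V) := by
  rintro b ⟨hb, hbV⟩
  obtain ⟨hab, hab'⟩ := hV a ha b hbV
  obtain ⟨hba, hba'⟩ := hV b hbV a ha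
  have hK0 : 0 < K := one_pos.trans hK
  have hKK : K ≤ K * K := le_mul_of_one_le_left hK0.le hK.le
  refine ⟨hab.le.trans hKK, hba.le.trans hKK, fun r hr => Icc_subset_Icc ?_ ?_ (hb r hr)⟩
  all_goals
    have := hr.1.le
    refine ENNReal.ofReal_le_ofReal (mul_le_mul_of_nonneg_right ?_ (by positivity))
  · rw [← div_div]
    gcongr
    exact (div_le_iff₀' hK0).2 hab'.le
  · rw [mul_assoc]
    gcongr
    exact hba'.le

theorem ae_exists_isComparable_mul_self (m : ℕ) (Λ : EuclideanSpace ℝ (Fin n) → GL (Fin n) ℝ)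
    (μ : Measure (EuclideanSpace ℝ (Fin n))) [IsLocallyFiniteMeasure μ] {K : ℝ} (hK : 1 < K) :
    ∀ᵐ a ∂μ, HasDensity m Λ μ a →
      ∃ S ρ, 0 < ρ ∧ IsComparable m Λ μ (K * K) ρ a S ∧ IsDensityPoint μ S a := by
  obtain ⟨𝒱, h𝒱, hcov, hclose⟩ := exists_countable_cover_of_eventually_nhds_diag
    (A := {a | HasDensity m Λ μ a}) fun a ha => HasDensity.eventually_isClose ha hK
  let 𝒮 := image2 (fun (j : ℕ) V => uniformDensitySet m Λ μ K (1 / ((j : ℝ) + 1)) ∩ V) univ 𝒱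
  have h𝒮 : 𝒮.Countable := countable_univ.image2 h𝒱 _
  filter_upwards [ae_forall_mem_isDensityPoint h𝒮] with a hdens ha
  obtain ⟨V, hV, haV⟩ := hcov ha
  obtain ⟨j, hj⟩ := ha.exists_mem_uniformDensitySet hK
  exact ⟨_, _, Nat.one_div_pos_of_nat, isComparable_uniformDensitySet_inter hK (hclose V hV) haV,
    hdens _ (mem_image2_of_mem (mem_univ j) hV) ⟨hj, haV⟩⟩

/-- Every neighbourhood of `a` is, up to factors arbitrarily close to `1` and sets of small
relative measure, filled with points whose ellipses look like those of `a`. -/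
def IsApproxHomogeneousAt (m : ℕ) (Λ : EuclideanSpace ℝ (Fin n) → GL (Fin n) ℝ)
    (μ : Measure (EuclideanSpace ℝ (Fin n))) (a : EuclideanSpace ℝ (Fin n)) : Prop :=
  ∀ K > 1, ∃ S ρ, 0 < ρ ∧ IsComparable m Λ μ K ρ a S ∧ IsDensityPoint μ S a

theorem ae_isApproxHomogeneousAt (m : ℕ) (Λ : EuclideanSpace ℝ (Fin n) → GL (Fin n) ℝ)
    (μ : Measure (EuclideanSpace ℝ (Fin n))) [IsLocallyFiniteMeasure μ] :
    ∀ᵐ a ∂μ, HasDensity m Λ μ a → IsApproxHomogeneousAt m Λ μ a := by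
  have hL (q : ℕ) : 1 < 1 + 1 / ((q : ℝ) + 1) := lt_add_of_pos_right 1 Nat.one_div_pos_of_nat
  filter_upwards [ae_all_iff.2 fun q => ae_exists_isComparable_mul_self m Λ μ (hL q)]
    with a h ha K hK
  have hlim : Tendsto (fun q : ℕ => (1 + 1 / ((q : ℝ) + 1)) * (1 + 1 / ((q : ℝ) + 1))) atTop
      (𝓝 1) := by
    have := tendsto_one_div_add_atTop_nhds_zero_nat (𝕜 := ℝ).const_add 1
    simpa using this.mul this
  obtain ⟨q, hq⟩ := (hlim.eventually_le_const hK).exists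
  obtain ⟨S, ρ, hρ, hcomp, hS⟩ := h q ha
  exact ⟨S, ρ, hρ, hcomp.mono (by positivity) hq, hS⟩

end Comparable

section BlowupLimit

/-- `ν` is the weak-* limit of the blow-ups `c i T^Λ_{a, r i}[μ]`, and the weights `c i` are
asymptotic to `b (r i)⁻ᵐ`. -/
structure IsBlowupLimit (m : ℕ) (Λ : EuclideanSpace ℝ (Fin n) → GL (Fin n) ℝ)
    (μ : Measure (EuclideanSpace ℝ (Fin n))) (a : EuclideanSpace ℝ (Fin n)) (c : ℕ → ℝ≥0)
    (r : ℕ → ℝ) (b : ℝ≥0∞) (ν : Measure (EuclideanSpace ℝ (Fin n))) : Prop where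
  radius_pos : ∀ i, 0 < r i
  tendsto_radius : Tendsto r atTop (𝓝 0)
  tendsto_weight : Tendsto (fun i => (c i : ℝ≥0∞) * ENNReal.ofReal (r i ^ m)) atTop (𝓝 b)
  weakStarTendsto : WeakStarTendsto (fun i => blowup Λ μ a (c i) (r i)) ν

theorem exists_isBlowupLimit_of_mem_tan (m : ℕ) (hν : ν ∈ Tan Λ μ a) :
    ∃ c r b, IsBlowupLimit m Λ μ a c r b ν := by
  obtain ⟨-, -, c, r, -, hr, hr0, h⟩ := hν
  obtain ⟨b, φ, hφ, hb⟩ := CompactSpace.tendsto_subseq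
    fun i => (c i : ℝ≥0∞) * ENNReal.ofReal (r i ^ m)
  exact ⟨c ∘ φ, r ∘ φ, b, fun i => hr (φ i), hr0.comp hφ.tendsto_atTop, hb,
    h.comp hφ.tendsto_atTop⟩

namespace IsBlowupLimit

variable {c : ℕ → ℝ≥0} {r : ℕ → ℝ} {b : ℝ≥0∞} {s t : ℝ}

theorem tendsto_mul_radius (h : IsBlowupLimit m Λ μ a c r b ν) (ht : 0 < t) :
    Tendsto (fun i => t * r i) atTop (𝓝[>] 0) :=
  tendsto_nhdsWithin_iff.2 ⟨by simpa using h.tendsto_radius.const_mul t,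
    Eventually.of_forall fun i => mul_pos ht (h.radius_pos i)⟩

theorem tendsto_weight_mul_ofReal (h : IsBlowupLimit m Λ μ a c r b ν) {k : ℝ} (hk : 0 ≤ k)
    (ht : 0 ≤ t) :
    Tendsto (fun i => (c i : ℝ≥0∞) * ENNReal.ofReal (k * (t * r i) ^ m)) atTop
      (𝓝 (ENNReal.ofReal (k * t ^ m) * b)) := by
  refine (ENNReal.Tendsto.const_mul h.tendsto_weight (Or.inr ENNReal.ofReal_ne_top)).congr
    fun i => ?_
  rw [mul_pow, ← mul_assoc k, ENNReal.ofReal_mul (p := k * t ^ m) (by positivity), mul_left_comm]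

theorem tendsto_weight_mul_measure_ellipse (h : IsBlowupLimit m Λ μ a c r b ν)
    (ha : HasDensity m Λ μ a) (ht : 0 < t) :
    Tendsto (fun i => (c i : ℝ≥0∞) * μ (ellipse Λ a (t * r i))) atTop
      (𝓝 (ENNReal.ofReal (t ^ m) * b * ENNReal.ofReal (density m Λ μ a))) := by
  have hweight := h.tendsto_weight_mul_ofReal zero_le_one ht.le
  simp only [one_mul] at hweight
  refine (ENNReal.Tendsto.mul hweight (Or.inr ENNReal.ofReal_ne_top)
    (ha.tendsto.comp (h.tendsto_mul_radius ht))
    (Or.inl (ENNReal.ofReal_pos.2 ha.density_pos).ne')).congr fun i => ?_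
  have hpow : 0 < (t * r i) ^ m := pow_pos (mul_pos ht (h.radius_pos i)) m
  rw [Function.comp_apply, mul_assoc,
    ENNReal.mul_div_cancel (ENNReal.ofReal_pos.2 hpow).ne' ENNReal.ofReal_ne_top]

theorem tendsto_blowup_closedBall_zero (h : IsBlowupLimit m Λ μ a c r b ν)
    (ha : HasDensity m Λ μ a) (ht : 0 < t) :
    Tendsto (fun i => blowup Λ μ a (c i) (r i) (Metric.closedBall 0 t)) atTop
      (𝓝 (ENNReal.ofReal (t ^ m) * b * ENNReal.ofReal (density m Λ μ a))) := by
  refine (h.tendsto_weight_mul_measure_ellipse ha ht).congr fun i => ?_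
  rw [blowup_apply measurableSet_closedBall, rescale_preimage_closedBall_zero (h.radius_pos i)]

theorem eventually_mul_radius_mem_Ioo (h : IsBlowupLimit m Λ μ a c r b ν) (ht : 0 < t) {ρ : ℝ}
    (hρ : 0 < ρ) : ∀ᶠ i in atTop, t * r i ∈ Ioo 0 ρ :=
  (h.tendsto_mul_radius ht).eventually (Ioo_mem_nhdsGT hρ)

theorem tendsto_weight_mul_measure_mul_one_sub (h : IsBlowupLimit m Λ μ a c r b ν)
    (ha : HasDensity m Λ μ a) (hb : b ≠ ∞) {S : Set (EuclideanSpace ℝ (Fin n))}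
    (hS : IsDensityPoint μ S a) (ht : 0 < t) :
    Tendsto (fun i => (c i : ℝ≥0∞) * (μ (Metric.closedBall a (t * r i)) *
      (1 - μ (S ∩ Metric.closedBall a (t * r i)) / μ (Metric.closedBall a (t * r i)))))
      atTop (𝓝 0) := by
  obtain ⟨T, hT, hT0⟩ : ∃ T, ‖act (Λ a)⁻¹‖ ≤ T ∧ 0 < T := ⟨_, (lt_add_one _).le, by positivity⟩
  have hratio : Tendsto (fun i => 1 - μ (S ∩ Metric.closedBall a (t * r i)) /
      μ (Metric.closedBall a (t * r i))) atTop (𝓝 0) := by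
    simpa only [tsub_self, Function.comp_def] using ENNReal.Tendsto.sub
      (tendsto_const_nhds (x := (1 : ℝ≥0∞))) (hS.comp (h.tendsto_mul_radius ht))
      (Or.inl ENNReal.one_ne_top)
  have hlimit : ENNReal.ofReal ((T * t) ^ m) * b * ENNReal.ofReal (density m Λ μ a) ≠ ∞ :=
    ENNReal.mul_ne_top (ENNReal.mul_ne_top ENNReal.ofReal_ne_top hb) ENNReal.ofReal_ne_top
  have hbound := ENNReal.Tendsto.mul (h.tendsto_weight_mul_measure_ellipse ha (mul_pos hT0 ht))
    (Or.inr ENNReal.zero_ne_top) hratio (Or.inr hlimit)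
  rw [mul_zero] at hbound
  refine tendsto_of_tendsto_of_tendsto_of_le_of_le tendsto_const_nhds hbound
    (fun _ => zero_le) fun i => ?_
  dsimp only
  rw [← mul_assoc, mul_assoc T]
  gcongr
  exact closedBall_subset_ellipse hT _

theorem eventually_exists_rescale_mem_closedBall [IsLocallyFiniteMeasure μ]
    [IsLocallyFiniteMeasure ν] (h : IsBlowupLimit m Λ μ a c r b ν) (ha : HasDensity m Λ μ a)
    (hb : b ≠ ∞) {S : Set (EuclideanSpace ℝ (Fin n))} (hS : IsDensityPoint μ S a)
    (hx : x ∈ ν.support) {η : ℝ} (hη : 0 < η) :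
    ∀ᶠ i in atTop, ∃ z ∈ S, rescale Λ a (r i) z ∈ Metric.closedBall x η := by
  obtain ⟨T, hT, hT0⟩ : ∃ T, ‖act (Λ a)‖ ≤ T ∧ 0 < T := ⟨_, (lt_add_one _).le, by positivity⟩
  have hR : 0 < T * (η + dist x 0) := by positivity
  obtain ⟨δ, hδ0, hδ⟩ := exists_between <|
    (Measure.mem_support_iff_forall x).1 hx _ (Metric.ball_mem_nhds x hη)
  have hmass := eventually_lt_of_lt_liminf <|
    hδ.trans_le (h.weakStarTendsto.measure_le_liminf_of_isOpen Metric.isOpen_ball)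
  have hdefect := (h.tendsto_weight_mul_measure_mul_one_sub ha hb hS hR).eventually_lt_const hδ0
  filter_upwards [hmass, hdefect] with i hmass hdefect
  by_contra! hdisj
  refine hmass.not_ge (le_trans ?_ hdefect.le)
  calc blowup Λ μ a (c i) (r i) (Metric.ball x η)
      ≤ c i * μ (rescale Λ a (r i) ⁻¹' Metric.closedBall x η) := by
        rw [← blowup_apply measurableSet_closedBall]
        exact measure_mono Metric.ball_subset_closedBall
    _ ≤ _ := by
        gcongr
        exact measure_le_mul_one_sub_of_disjoint
          ((continuous_rescale Λ a (r i)).measurable measurableSet_closedBall)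
          (rescale_preimage_subset_closedBall (h.radius_pos i) hT x η)
          (disjoint_left.2 hdisj) measure_closedBall_lt_top.ne

theorem le_measure_closedBall_zero [IsLocallyFiniteMeasure μ] [IsLocallyFiniteMeasure ν]
    (h : IsBlowupLimit m Λ μ a c r b ν) (ha : HasDensity m Λ μ a) (hs : 0 < s) :
    ENNReal.ofReal (s ^ m) * b * ENNReal.ofReal (density m Λ μ a) ≤ ν (Metric.closedBall 0 s) := by
  have (i : ℕ) := isLocallyFiniteMeasure_blowup (Λ := Λ) (μ := μ) (a := a) (c i) (h.radius_pos i)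
  rw [← (h.tendsto_blowup_closedBall_zero ha hs).limsup_eq]
  exact h.weakStarTendsto.limsup_measure_le_of_isCompact (isCompact_closedBall 0 s)

theorem measure_ball_zero_le [IsLocallyFiniteMeasure ν] (h : IsBlowupLimit m Λ μ a c r b ν)
    (ha : HasDensity m Λ μ a) (hs : 0 < s) :
    ν (Metric.ball 0 s) ≤ ENNReal.ofReal (s ^ m) * b * ENNReal.ofReal (density m Λ μ a) := by
  rw [← (h.tendsto_blowup_closedBall_zero ha hs).liminf_eq]
  exact (h.weakStarTendsto.measure_le_liminf_of_isOpen Metric.isOpen_ball).trans <|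
    liminf_le_liminf <| Eventually.of_forall fun _ => measure_mono Metric.ball_subset_closedBall

theorem weight_ne_top [IsLocallyFiniteMeasure μ] [IsLocallyFiniteMeasure ν]
    (h : IsBlowupLimit m Λ μ a c r b ν) (ha : HasDensity m Λ μ a) : b ≠ ∞ := by
  rintro rfl
  have htop := h.le_measure_closedBall_zero ha one_pos
  rw [one_pow, ENNReal.ofReal_one, one_mul,
    ENNReal.top_mul (ENNReal.ofReal_pos.2 ha.density_pos).ne'] at htop
  exact measure_closedBall_lt_top.not_ge htop

theorem weight_ne_zero [IsLocallyFiniteMeasure ν] (h : IsBlowupLimit m Λ μ a c r b ν)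
    (ha : HasDensity m Λ μ a) (hν : ν ≠ 0) : b ≠ 0 := by
  rintro rfl
  refine hν (Measure.measure_univ_eq_zero.1 ?_)
  rw [← Metric.iUnion_ball_nat_succ (0 : EuclideanSpace ℝ (Fin n)), measure_iUnion_null_iff]
  intro k
  simpa using h.measure_ball_zero_le ha k.cast_add_one_pos

theorem zero_mem_support [IsLocallyFiniteMeasure μ] [IsLocallyFiniteMeasure ν]
    (h : IsBlowupLimit m Λ μ a c r b ν) (ha : HasDensity m Λ μ a) (hν : ν ≠ 0) :
    0 ∈ ν.support := by
  refine Metric.nhds_basis_closedBall.mem_measureSupport.2 fun s hs => ?_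
  refine lt_of_lt_of_le ?_ (h.le_measure_closedBall_zero ha hs)
  exact ENNReal.mul_pos (mul_ne_zero (ENNReal.ofReal_pos.2 (pow_pos hs m)).ne'
    (h.weight_ne_zero ha hν)) (ENNReal.ofReal_pos.2 ha.density_pos).ne'

section Comparable

variable [IsLocallyFiniteMeasure μ] [IsLocallyFiniteMeasure ν] {K ρ : ℝ}
  {S : Set (EuclideanSpace ℝ (Fin n))}

theorem measure_closedBall_le (h : IsBlowupLimit m Λ μ a c r b ν) (ha : HasDensity m Λ μ a)
    (hK : 1 < K) (hρ : 0 < ρ) (hcomp : IsComparable m Λ μ K ρ a S) (hS : IsDensityPoint μ S a)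
    (hx : x ∈ ν.support) (hs : 0 < s) :
    ν (Metric.closedBall x s) ≤
      ENNReal.ofReal (K * density m Λ μ a * (K * (K * s)) ^ m) * b := by
  have hK0 : 0 < K := one_pos.trans hK
  obtain ⟨η, hη, hsη⟩ : ∃ η > 0, s + η + η = K * s :=
    ⟨(K - 1) * s / 2, div_pos (mul_pos (sub_pos.2 hK) hs) two_pos, by ring⟩
  have hpoints := h.eventually_exists_rescale_mem_closedBall ha (h.weight_ne_top ha) hS hx hη
  have hsmall := h.eventually_mul_radius_mem_Ioo (mul_pos hK0 (mul_pos hK0 hs)) hρ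
  calc ν (Metric.closedBall x s)
      ≤ ν (Metric.ball x (s + η)) :=
        measure_mono (Metric.closedBall_subset_ball (lt_add_of_pos_right s hη))
    _ ≤ liminf (fun i => blowup Λ μ a (c i) (r i) (Metric.ball x (s + η))) atTop :=
        h.weakStarTendsto.measure_le_liminf_of_isOpen Metric.isOpen_ball
    _ ≤ liminf (fun i => c i * ENNReal.ofReal
          (K * density m Λ μ a * (K * (K * s) * r i) ^ m)) atTop := by
        refine liminf_le_liminf ?_
        filter_upwards [hpoints, hsmall] with i ⟨z, hzS, hz⟩ hi
        rw [blowup_apply measurableSet_ball]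
        gcongr
        have hball : Metric.ball x (s + η) ⊆ Metric.closedBall (rescale Λ a (r i) z) (K * s) :=
          Metric.ball_subset_closedBall.trans <| Metric.closedBall_subset_closedBall' <| by
            linarith [Metric.mem_closedBall'.1 hz]
        obtain ⟨-, hza, hmass⟩ := hcomp z hzS
        exact (measure_mono ((preimage_mono hball).trans
          (rescale_preimage_subset_ellipse (h.radius_pos i) hza _))).trans (hmass _ hi).2
    _ = ENNReal.ofReal (K * density m Λ μ a * (K * (K * s)) ^ m) * b :=
        (h.tendsto_weight_mul_ofReal (mul_nonneg hK0.le (density_nonneg a))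
          (by positivity)).liminf_eq

theorem le_measure_closedBall (h : IsBlowupLimit m Λ μ a c r b ν) (ha : HasDensity m Λ μ a)
    (hK : 1 < K) (hρ : 0 < ρ) (hcomp : IsComparable m Λ μ K ρ a S) (hS : IsDensityPoint μ S a)
    (hx : x ∈ ν.support) (hs : 0 < s) :
    ENNReal.ofReal (density m Λ μ a / K * (s / K / K) ^ m) * b ≤ ν (Metric.closedBall x s) := by
  have hK0 : 0 < K := one_pos.trans hK
  have hη : 0 < s - s / K := sub_pos.2 (div_lt_self hs hK)
  have hpoints := h.eventually_exists_rescale_mem_closedBall ha (h.weight_ne_top ha) hS hx hη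
  have hsmall := h.eventually_mul_radius_mem_Ioo (div_pos (div_pos hs hK0) hK0) hρ
  have (i : ℕ) := isLocallyFiniteMeasure_blowup (Λ := Λ) (μ := μ) (a := a) (c i) (h.radius_pos i)
  calc ENNReal.ofReal (density m Λ μ a / K * (s / K / K) ^ m) * b
      = limsup (fun i => c i * ENNReal.ofReal
          (density m Λ μ a / K * (s / K / K * r i) ^ m)) atTop :=
        (h.tendsto_weight_mul_ofReal (div_nonneg (density_nonneg a) hK0.le)
          (by positivity)).limsup_eq.symm
    _ ≤ limsup (fun i => blowup Λ μ a (c i) (r i) (Metric.closedBall x s)) atTop := by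
        refine limsup_le_limsup ?_
        filter_upwards [hpoints, hsmall] with i ⟨z, hzS, hz⟩ hi
        rw [blowup_apply measurableSet_closedBall]
        gcongr
        have hball : Metric.closedBall (rescale Λ a (r i) z) (K * (s / K / K)) ⊆
            Metric.closedBall x s :=
          Metric.closedBall_subset_closedBall' <| by
            rw [mul_div_cancel₀ _ hK0.ne']
            linarith [Metric.mem_closedBall.1 hz]
        obtain ⟨haz, -, hmass⟩ := hcomp z hzS
        exact (hmass _ hi).1.trans (measure_mono
          ((ellipse_subset_rescale_preimage (h.radius_pos i) haz _).trans (preimage_mono hball)))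
    _ ≤ ν (Metric.closedBall x s) :=
        h.weakStarTendsto.limsup_measure_le_of_isCompact (isCompact_closedBall x s)

theorem measure_closedBall_of_mem_support (h : IsBlowupLimit m Λ μ a c r b ν)
    (ha : HasDensity m Λ μ a) (hhom : IsApproxHomogeneousAt m Λ μ a) (hx : x ∈ ν.support)
    (hs : 0 < s) :
    ν (Metric.closedBall x s) = ENNReal.ofReal (density m Λ μ a * s ^ m) * b := by
  have hb := h.weight_ne_top ha
  have hlim {f : ℝ → ℝ} (hf : ContinuousAt f 1) :
      Tendsto (fun K => ENNReal.ofReal (f K) * b) (𝓝[>] 1) (𝓝 (ENNReal.ofReal (f 1) * b)) :=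
    (ENNReal.Tendsto.mul_const (ENNReal.tendsto_ofReal hf) (Or.inr hb)).mono_left
      nhdsWithin_le_nhds
  apply le_antisymm
  · have hupper := hlim (f := fun K => K * density m Λ μ a * (K * (K * s)) ^ m) (by fun_prop)
    simp only [one_mul] at hupper
    refine ge_of_tendsto hupper (eventually_mem_nhdsWithin.mono fun K hK => ?_)
    obtain ⟨S, ρ, hρ, hcomp, hS⟩ := hhom K hK
    exact h.measure_closedBall_le ha hK hρ hcomp hS hx hs
  · have hlower := hlim (f := fun K => density m Λ μ a / K * (s / K / K) ^ m)
      (by fun_prop (disch := norm_num))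
    simp only [div_one] at hlower
    refine le_of_tendsto hlower (eventually_mem_nhdsWithin.mono fun K hK => ?_)
    obtain ⟨S, ρ, hρ, hcomp, hS⟩ := hhom K hK
    exact h.le_measure_closedBall ha hK hρ hcomp hS hx hs

end Comparable

end IsBlowupLimit

end BlowupLimit

section Uniform

theorem IsApproxHomogeneousAt.isUniform_of_mem_tan [IsLocallyFiniteMeasure μ]
    (hhom : IsApproxHomogeneousAt m Λ μ a) (ha : HasDensity m Λ μ a) (hν : ν ∈ Tan Λ μ a) :
    IsUniform m ν := by
  obtain ⟨c, r, b, h⟩ := exists_isBlowupLimit_of_mem_tan m hν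
  obtain ⟨hfin, hν0, -⟩ := hν
  refine ⟨hfin, h.zero_mem_support ha hν0, b.toReal * density m Λ μ a,
    mul_pos (ENNReal.toReal_pos (h.weight_ne_zero ha hν0) (h.weight_ne_top ha)) ha.density_pos,
    fun x hx s hs => ?_⟩
  rw [h.measure_closedBall_of_mem_support ha hhom hx hs, mul_assoc,
    ENNReal.ofReal_mul ENNReal.toReal_nonneg, ENNReal.ofReal_toReal (h.weight_ne_top ha), mul_comm]

theorem IsUniform.measure_closedBall (hν : IsUniform m ν) (hx : x ∈ ν.support) {r : ℝ}
    (hr : 0 < r) :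
    ν (Metric.closedBall x r) = ν (Metric.closedBall 0 1) * ENNReal.ofReal (r ^ m) := by
  obtain ⟨-, h0, c, hc, hball⟩ := hν
  rw [hball x hx r hr, hball 0 h0 1 one_pos, one_pow, mul_one, ENNReal.ofReal_mul hc.le]

end Uniform

end LambdaTangent

theorem theoremt_general (n m : ℕ) (Λ : EuclideanSpace ℝ (Fin n) → GL (Fin n) ℝ)
    (μ : Measure (EuclideanSpace ℝ (Fin n))) [IsLocallyFiniteMeasure μ] :
    ∀ᵐ a ∂μ, LambdaTangent.HasDensity m Λ μ a → ∀ ν ∈ LambdaTangent.Tan Λ μ a,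
      LambdaTangent.IsUniform m ν ∧
        ∀ x ∈ ν.support, ∀ r : ℝ, 0 < r →
          ν (Metric.closedBall x r) = ν (Metric.closedBall 0 1) * ENNReal.ofReal (r ^ m) := by
  filter_upwards [LambdaTangent.ae_isApproxHomogeneousAt m Λ μ] with a hhom ha ν hν
  have huniform := (hhom ha).isUniform_of_mem_tan ha hν
  exact ⟨huniform, fun x hx r hr => huniform.measure_closedBall hx hr⟩

theorem theoremt (n m : ℕ)
    (Λ : EuclideanSpace ℝ (Fin n) → Matrix.GeneralLinearGroup (Fin n) ℝ)
    (μ : MeasureTheory.Measure (EuclideanSpace ℝ (Fin n)))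
    [MeasureTheory.IsLocallyFiniteMeasure μ]
    (hμ : ∀ᵐ a ∂μ, LambdaTangent.HasDensity m Λ μ a) :
    ∀ᵐ a ∂μ, ∀ ν ∈ LambdaTangent.Tan Λ μ a,
      LambdaTangent.IsUniform m ν ∧
        ∀ x ∈ ν.support, ∀ r : ℝ, 0 < r →
          ν (Metric.closedBall x r) = ν (Metric.closedBall 0 1) * ENNReal.ofReal (r ^ m) := by
  filter_upwards [theoremt_general n m Λ μ, hμ] with a h ha using h ha
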